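/- Let $d\ge 0$ be an integer. For $\rho>0$ let $\mathcal M_\rho$ be the set of finite measures $\mu$ on $\mathbb R^d$ for which there are $A,B>0$ with $\int e^{u^Tx}\,d\mu(x)\le A\,e^{B\|u\|^\rho}$ for all $u\in\mathbb R^d$ ($\|\cdot\|$ is the Euclidean norm). For a probability measure $R$ on $\mathbb R^d\times\mathbb R^d$ with both marginals in $\mathcal M_\rho$, put $$\Phi_R(z_1,z_2)=\int \exp(z_1^Tx_1+z_2^Tx_2)\,dR(x_1,x_2),\qquad z_1,z_2\in\mathbb C^d,$$ and say that $R$ satisfies H1 if for every $z_0\in\mathbb C^d$ the function $z\mapsto\Phi_R(z_0,z)$ is not identically zero or the function $z\mapsto\Phi_R(z,z_0)$ is not identically zero. A hidden regression model is $Y_i=g(Z_i)+\varepsilon_i$, $i\ge1$, where $(Z_i)_{i\ge1}$ is a strictly stationary (not necessarily Markov) sequence of random variables in a measurable space, $g$ is a measurable map from that space to $\mathbb R^d$, and $(\varepsilon_i)_{i\ge1}$ is a sequence of independent and identically distributed $\mathbb R^d$-valued random variables with arbitrary law $P$, independent of $(g(Z_i))_{i\ge1}$. Let $R$ be the law of $(g(Z_1),g(Z_2))$.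 **Corollary.** Consider two hidden regression models $Y_i=g(Z_i)+\varepsilon_i$ and $\widetilde Y_i=\widetilde g(\widetilde Z_i)+\widetilde\varepsilon_i$ in $\mathbb R^d$, possibly with different probability spaces, hidden state spaces and regression functions. Let $(R,P)$ and $(\widetilde R,\widetilde P)$ be the associated pairs of laws. Assume that the law of $g(Z_1)$ belongs to $\mathcal M_\rho$ for some $\rho\in(0,2)$, that the law of $\widetilde g(\widetilde Z_1)$ belongs to $\mathcal M_{\widetilde\rho}$ for some $\widetilde\rho\in(0,2)$, and that $R$ and $\widetilde R$ satisfy H1. Then $(Y_1,Y_2)$ and $(\widetilde Y_1,\widetilde Y_2)$ have the same law if and only if $(R,P)$ and $(\widetilde R,\widetilde P)$ are equal up to translation, that is, there is $m\in\mathbb R^d$ such that $\widetilde R$ is the law of $(g(Z_1)-m,\,g(Z_2)-m)$ and $\widetilde P$ is the law of $\varepsilon_1+m$. In other words, the map that sends $(R,P)$ to the law of $(Y_1,Y_2)$ is well defined and one-to-one up to translation. -/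

import Mathlib

open MeasureTheory ProbabilityTheory

namespace HiddenRegression

/-- The class `M_ρ` of finite measures on `ℝ^d` whose Laplace transform is finite everywhere and
satisfies `∫ exp (uᵀ x) dμ(x) ≤ A exp (B ‖u‖ ^ ρ)` for all `u`, for some constants `A, B > 0`. -/
def MClass (d : ℕ) (ρ : ℝ) : Set (Measure (EuclideanSpace ℝ (Fin d))) :=
  {μ | IsFiniteMeasure μ ∧ ∃ A B : ℝ, 0 < A ∧ 0 < B ∧ ∀ u : EuclideanSpace ℝ (Fin d),
    Integrable (fun x => Real.exp (inner ℝ u x)) μ ∧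
      ∫ x, Real.exp (inner ℝ u x) ∂μ ≤ A * Real.exp (B * ‖u‖ ^ ρ)}

/-- The bilinear pairing `zᵀ x = ∑ j, z_j x_j` of `z ∈ ℂ^d` with `x ∈ ℝ^d` (no conjugation). -/
def cdot {d : ℕ} (z : Fin d → ℂ) (x : EuclideanSpace ℝ (Fin d)) : ℂ :=
  ∑ j, z j * (x j : ℂ)

/-- `Φ_R (z₁, z₂) = ∫ exp (z₁ᵀ x₁ + z₂ᵀ x₂) dR(x₁, x₂)` for `z₁, z₂ ∈ ℂ^d`. -/
noncomputable def Phi {d : ℕ}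
    (R : Measure (EuclideanSpace ℝ (Fin d) × EuclideanSpace ℝ (Fin d)))
    (z₁ z₂ : Fin d → ℂ) : ℂ :=
  ∫ x, Complex.exp (cdot z₁ x.1 + cdot z₂ x.2) ∂ R

/-- Assumption H1: for every `z₀ ∈ ℂ^d`, `z ↦ Φ_R (z₀, z)` is not the null function or
`z ↦ Φ_R (z, z₀)` is not the null function. -/
def H1 {d : ℕ} (R : Measure (EuclideanSpace ℝ (Fin d) × EuclideanSpace ℝ (Fin d))) : Prop :=
  ∀ z₀ : Fin d → ℂ, (fun z => Phi R z₀ z) ≠ 0 ∨ (fun z => Phi R z z₀) ≠ 0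

/-- Strict stationarity: every time shift of the sequence has the law of the sequence. -/
def IsStationary {Ω E : Type*} [MeasurableSpace Ω] [MeasurableSpace E]
    (μ : Measure Ω) (Z : ℕ → Ω → E) : Prop :=
  ∀ k : ℕ, IdentDistrib (fun ω (i : ℕ) => Z (i + k) ω) (fun ω (i : ℕ) => Z i ω) μ μ

/-- The hidden regression model `Y_i = g (Z_i) + ε_i`: `Z` is stationary, the noise variables
`ε_i` are independent and identically distributed, and the noise sequence is independent of the
hidden signal `(g (Z_i))_i`. The time index starts at `0` instead of `1`. -/
structure IsHiddenRegression {Ω E : Type*} [MeasurableSpace Ω] [MeasurableSpace E] {d : ℕ}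
    (μ : Measure Ω) (Z : ℕ → Ω → E) (g : E → EuclideanSpace ℝ (Fin d))
    (ε Y : ℕ → Ω → EuclideanSpace ℝ (Fin d)) : Prop where
  measurable_Z : ∀ i, Measurable (Z i)
  measurable_g : Measurable g
  measurable_noise : ∀ i, Measurable (ε i)
  stationary : IsStationary μ Z
  iIndep_noise : iIndepFun ε μ
  identDistrib_noise : ∀ i, IdentDistrib (ε i) (ε 0) μ μ
  indep_signal_noise : IndepFun (fun ω (i : ℕ) => g (Z i ω)) (fun ω (i : ℕ) => ε i ω) μ
  observation : ∀ i ω, Y i ω = g (Z i ω) + ε i ω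

/-- The law of the first two terms of a sequence of random variables. -/
noncomputable def pairLaw {Ω F : Type*} [MeasurableSpace Ω] [MeasurableSpace F]
    (μ : Measure Ω) (X : ℕ → Ω → F) : Measure (F × F) :=
  μ.map (fun ω => (X 0 ω, X 1 ω))

/-- `R = R'` and `P = P'` up to translation: for some `m ∈ ℝ^d`, if `(X₁, X₂)` has law `R` and
`ε` has law `P`, then `(X₁ - m, X₂ - m)` has law `R'` and `ε + m` has law `P'`. -/
def EqUpToTranslation {d : ℕ}
    (R : Measure (EuclideanSpace ℝ (Fin d) × EuclideanSpace ℝ (Fin d)))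
    (P : Measure (EuclideanSpace ℝ (Fin d)))
    (R' : Measure (EuclideanSpace ℝ (Fin d) × EuclideanSpace ℝ (Fin d)))
    (P' : Measure (EuclideanSpace ℝ (Fin d))) : Prop :=
  ∃ m : EuclideanSpace ℝ (Fin d),
    R.map (fun x => (x.1 - m, x.2 - m)) = R' ∧ P.map (fun e => e + m) = P'

end HiddenRegression

namespace HiddenRegression

/-! Write `f = Φ_R(·, 0)`, `f' = Φ_R'(·, 0)`, and `p`, `p'` for the characteristic functions of the
noises. At purely imaginary arguments the transform of two observations is `Φ_R(it₁, it₂) p(t₁)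
p(t₂)`, and `t₂ = 0` leaves `f(it₁) p(t₁)`. If the observed laws agree, the noise can be eliminated
near `0`, where `p'` does not vanish; analytic continuation gives `Φ_R'(z₁, z₂) f(z₁) f(z₂) =
Φ_R(z₁, z₂) f'(z₁) f'(z₂)` on all of `ℂ^d × ℂ^d` (`Phi_mul_marginals_eq`).

Freeze one variable where H1 keeps `Φ_R` from vanishing: every zero of `f` on a complex line is then
a zero of `f'` of at least the same order, and H1 for `R'` gives the converse
(`analyticOrderAt_line_le`). Along a real direction both functions have order of growth below two,
so Hadamard's theorem gives `f'(sv) = f(sv) exp(cs)` (`eq_mul_exp_of_analyticOrderAt_eq`).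
Differentiating at `s = 0` identifies `c` as the pairing of `v` with the difference of the means, so
`c` is linear in `v` and the factor is that of a translation. Cancelling `f(z₁) f(z₂)` in the
product identity, and `f` in `f p = f' p'`, yields the two laws.

Analyticity is only used along complex lines, so one complex variable suffices. -/

/-! ### Hadamard factorization for growth `exp (o(r²))`. -/

open Metric Real Filter Topology in
/-- If `F` is entire with `F 0 = 1` and `‖F‖ ≤ exp M` on a circle, then the mean of `|log ‖F‖|` on
this circle is at most `2 M`. -/
theorem circleAverage_abs_log_norm_le {F : ℂ → ℂ} (hF : Differentiable ℂ F) (h0 : F 0 = 1)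
    {R M : ℝ} (hR : 0 < R) (hM : ∀ z ∈ sphere (0 : ℂ) R, Real.log ‖F z‖ ≤ M) (hM0 : 0 ≤ M) :
    circleAverage (fun z => |Real.log ‖F z‖|) 0 R ≤ 2 * M := by
  have hA : AnalyticOnNhd ℂ F (closedBall 0 |R|) := fun z _ => hF.analyticAt z
  have hint : CircleIntegrable (fun z => Real.log ‖F z‖) 0 R :=
    MeromorphicOn.circleIntegrable_log_norm fun z _ => (hF.analyticAt z).meromorphicAt
  -- Jensen's formula: each zero `u` contributes its order times `log (R / ‖u‖) ≥ 0`. For `u = 0`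
  -- the convention `log 0 = 0` applies.
  have hmean : 0 ≤ circleAverage (fun z => Real.log ‖F z‖) 0 R := by
    rw [AnalyticOnNhd.circleAverage_log_norm hR.ne' hA (by simp [h0])]
    simp only [h0, norm_one, Real.log_one, add_zero]
    refine finsum_nonneg fun u => ?_
    by_cases hu : u ∈ closedBall (0 : ℂ) |R|
    · refine mul_nonneg ?_ ?_
      · exact_mod_cast MeromorphicOn.AnalyticOnNhd.divisor_nonneg hA u
      · rcases eq_or_ne u 0 with rfl | hu0
        · simp
        · refine Real.log_nonneg ?_
          rw [abs_of_pos hR, mem_closedBall, dist_zero_right] at hu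
          rw [zero_sub, norm_neg, ← div_eq_mul_inv, one_le_div (norm_pos_iff.2 hu0)]
          exact hu
    · rw [Function.locallyFinsuppWithin.apply_eq_zero_of_notMem _ hu]
      simp
  -- From `x ≤ M` and `0 ≤ M` follows `|x| ≤ 2 M - x`, so a lower bound on the mean of `x` is
  -- enough.
  calc circleAverage (fun z => |Real.log ‖F z‖|) 0 R
      ≤ circleAverage (fun z => 2 * M - Real.log ‖F z‖) 0 R := by
        refine circleAverage_mono hint.abs ((circleIntegrable_const _ _ _).sub hint) fun z hz => ?_
        rw [abs_of_pos hR] at hz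
        have := hM z hz
        exact abs_le'.2 ⟨by linarith, by linarith⟩
    _ = 2 * M - circleAverage (fun z => Real.log ‖F z‖) 0 R := by
        have := circleAverage_sub (circleIntegrable_const (2 * M) 0 R) hint
        rw [circleAverage_const] at this
        exact this
    _ ≤ 2 * M := by linarith

/-- A nowhere vanishing entire function is the exponential of an entire function. -/
theorem exists_differentiable_exp_eq {h : ℂ → ℂ} (hh : Differentiable ℂ h) (hne : ∀ z, h z ≠ 0)
    (h0 : h 0 = 1) :
    ∃ q : ℂ → ℂ, Differentiable ℂ q ∧ q 0 = 0 ∧ ∀ z, h z = Complex.exp (q z) := by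
  have hd : Differentiable ℂ fun z => deriv h z / h z :=
    (Differentiable.div hh.contDiff.differentiable_deriv_two hh hne)
  obtain ⟨q₀, hq₀⟩ := hd.isExactOn_univ
  have hq : ∀ z, HasDerivAt (fun z => q₀ z - q₀ 0) (deriv h z / h z) z := fun z =>
    (hq₀ z trivial).sub_const _
  refine ⟨fun z => q₀ z - q₀ 0, fun z => (hq z).differentiableAt, sub_self _, fun z => ?_⟩
  have hk : ∀ z, HasDerivAt (fun z => h z * Complex.exp (-(q₀ z - q₀ 0))) 0 z := fun z => by
    have := (hh z).hasDerivAt.mul (hq z).neg.cexp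
    refine HasDerivAt.congr_deriv (f := fun z => h z * Complex.exp (-(q₀ z - q₀ 0))) this ?_
    have := hne z
    field_simp
    ring
  have hconst := is_const_of_deriv_eq_zero (fun z => (hk z).differentiableAt)
    (fun z => (hk z).deriv) z 0
  simp only [h0, sub_self, neg_zero, Complex.exp_zero, mul_one, Complex.exp_neg] at hconst
  field_simp [Complex.exp_ne_zero] at hconst
  exact hconst

open Metric Real Filter Topology in
/-- Poisson bound for the real part of an entire function by its mean on a larger circle. -/
theorem abs_re_le_circleAverage {q : ℂ → ℂ} (hq : Differentiable ℂ q) {R : ℝ} (hR : 0 < R)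
    {w : ℂ} (hw : ‖w‖ ≤ R / 2) :
    |(q w).re| ≤ 3 * circleAverage (fun z => |(q z).re|) 0 R := by
  have hH : InnerProductSpace.HarmonicOnNhd (fun z => (q z).re) (closedBall 0 R) :=
    fun z _ => (hq.analyticAt z).harmonicAt_re
  have hwR : w ∈ ball (0 : ℂ) R := by rw [mem_ball_zero_iff]; linarith
  have hP := hH.circleAverage_re_herglotzRieszKernel_smul hwR
  have hcont : Continuous fun z => |(q z).re| := by have := hq.continuous; fun_prop
  rw [← hP]
  refine abs_circleAverage_le_circleAverage_abs.trans ?_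
  have h3 := circleAverage_fun_smul (a := (3 : ℝ)) (f := fun z => |(q z).re|) (c := 0) (R := R)
  simp only [smul_eq_mul] at h3
  rw [← h3]
  refine circleAverage_mono ?_ ?_ fun z hz => ?_
  · refine ContinuousOn.circleIntegrable hR.le ?_
    refine ContinuousOn.abs ?_
    refine ContinuousOn.smul ?_ (by have := hq.continuous; fun_prop)
    have := continuousOn_herglotzRieszKernel_sphere (c := 0) (R := R) (w := w) hwR
    rw [abs_of_pos hR] at this
    exact Complex.continuous_re.comp_continuousOn this
  · exact (continuous_const.mul hcont).continuousOn.circleIntegrable hR.le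
  -- The Poisson kernel is nonnegative and at most `(R + ‖w‖) / (R - ‖w‖) ≤ 3`, as `‖w‖ ≤ R / 2`.
  · rw [abs_of_pos hR] at hz
    have h1 := re_herglotzRieszKernel_le hz hwR
    have h2 := le_re_herglotzRieszKernel hz hwR
    change |(herglotzRieszKernel 0 w z).re * (q z).re| ≤ 3 * |(q z).re|
    rw [herglotzRieszKernel_def, abs_mul]
    simp only [sub_zero] at h1 h2 ⊢
    refine mul_le_mul_of_nonneg_right ?_ (abs_nonneg _)
    rw [abs_of_nonneg (le_trans (div_nonneg (by linarith [norm_nonneg w])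
      (by linarith [norm_nonneg w])) h2)]
    refine h1.trans ?_
    rw [div_le_iff₀ (by linarith)]
    linarith

open Metric Real Filter Topology Asymptotics in
/-- An entire function vanishing at `0` whose real part has means of size `o(R²)` is linear. -/
theorem eq_mul_of_circleAverage_isLittleO {q : ℂ → ℂ} (hq : Differentiable ℂ q) (q0 : q 0 = 0)
    {φ : ℝ → ℝ} (hφ : φ =o[atTop] fun r => r ^ 2)
    (hle : ∀ R > 0, circleAverage (fun z => |(q z).re|) 0 R ≤ φ R) :
    ∃ c : ℂ, ∀ z, q z = c * z := by
  have hbound : ∀ ε > 0, ∀ᶠ R in atTop, ∀ z : ℂ, ‖z‖ ≤ R / 4 → ‖q z‖ ≤ 6 * (ε * R ^ 2) := by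
    intro ε hε
    filter_upwards [hφ.def hε, eventually_gt_atTop 0] with R hR hR0 z hz
    have hM : (0 : ℝ) < 3 * (ε * R ^ 2) := by positivity
    -- On the disc of radius `R / 2` the real part is at most `M = 3 ε R²`. For `‖z‖ ≤ R / 4` the
    -- factor `2 ‖z‖ / (R / 2 - ‖z‖)` is at most `2`, whence the `6`.
    have hb := Complex.borelCaratheodory_zero (f := q) (M := 3 * (ε * R ^ 2)) (R := R / 2) (z := z)
      hM hq.differentiableOn (fun w hw => ?_) (by positivity)
      (by rw [mem_ball_zero_iff]; linarith) q0
    · refine hb.trans ?_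
      rw [div_le_iff₀ (by linarith)]
      nlinarith [norm_nonneg z]
    · rw [mem_ball_zero_iff] at hw
      have h1 := abs_re_le_circleAverage hq hR0 hw.le
      have h2 := hle R hR0
      rw [Real.norm_eq_abs, Real.norm_eq_abs, abs_of_nonneg (sq_nonneg R)] at hR
      exact (le_abs_self _).trans (h1.trans (by linarith [le_abs_self (φ R)]))
  have hd2 : ∀ z, iteratedDeriv 2 q z = 0 := by
    intro z
    rw [← norm_le_zero_iff]
    refine le_of_forall_pos_le_add fun ε hε => ?_
    -- Cauchy's estimate on the circle of radius `R / 8` about `z`, which lies in `‖w‖ ≤ R / 4`,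
    -- gives `2! * 6 * 64 * ε / 1000 ≤ ε`.
    obtain ⟨R, hR, hzR⟩ := ((hbound (ε / 1000) (by positivity)).and
      (eventually_ge_atTop (8 * ‖z‖ + 1))).exists
    have hR0 : 0 < R := by linarith [norm_nonneg z]
    have := Complex.norm_iteratedDeriv_le_of_forall_mem_sphere_norm_le (c := z) (R := R / 8)
      (C := 6 * (ε / 1000 * R ^ 2)) 2 (by positivity) hq.diffContOnCl fun w hw => hR w ?_
    · refine this.trans ?_
      rw [div_le_iff₀ (by positivity)]
      norm_num [Nat.factorial]
      nlinarith [mul_pos hε (pow_pos hR0 2)]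
    · rw [mem_sphere_iff_norm] at hw
      have := norm_add_le (w - z) z
      rw [sub_add_cancel] at this
      linarith
  have hq1 : Differentiable ℂ (deriv q) := hq.contDiff.differentiable_deriv_two
  have hconst : ∀ z, deriv q z = deriv q 0 := fun z => is_const_of_deriv_eq_zero hq1
    (fun w => by rw [← hd2 w, iteratedDeriv_succ, iteratedDeriv_one]) z 0
  refine ⟨deriv q 0, fun z => ?_⟩
  have hk : ∀ w, HasDerivAt (fun w => q w - deriv q 0 * w) 0 w := fun w => by
    have := (hq w).hasDerivAt.sub ((hasDerivAt_id w).const_mul (deriv q 0))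
    rwa [hconst w, mul_one, sub_self] at this
  have := is_const_of_deriv_eq_zero (fun w => (hk w).differentiableAt)
    (fun w => (hk w).deriv) z 0
  simp only [q0, mul_zero, sub_zero] at this
  exact sub_eq_zero.1 this

/-- Entire functions, not identically zero, with zeros of the same orders differ by a nowhere
vanishing entire factor. -/
theorem exists_nonvanishing_factor {F G : ℂ → ℂ} (hF : Differentiable ℂ F)
    (hG : Differentiable ℂ G) (hord : ∀ z, analyticOrderAt F z = analyticOrderAt G z)
    (hfin : ∀ z, analyticOrderAt F z ≠ ⊤) :
    ∃ h : ℂ → ℂ, Differentiable ℂ h ∧ (∀ z, h z ≠ 0) ∧ ∀ z, G z = F z * h z := by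
  have hFm : ∀ z, MeromorphicAt F z := fun z => (hF.analyticAt z).meromorphicAt
  have hGm : ∀ z, MeromorphicAt G z := fun z => (hG.analyticAt z).meromorphicAt
  have hm : MeromorphicOn (G * F⁻¹) Set.univ := fun z _ => (hGm z).mul (hFm z).inv
  -- The normal form replaces the default values of `G / F` at zeros of `F` by the true ones; order
  -- zero everywhere then means analytic and nowhere zero.
  set h := toMeromorphicNFOn (G * F⁻¹) Set.univ with hdef
  have hNF : ∀ z, MeromorphicNFAt h z := fun z => meromorphicNFOn_toMeromorphicNFOn _ _ trivial
  have hord0 : ∀ z, meromorphicOrderAt h z = 0 := by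
    intro z
    rw [hdef, meromorphicOrderAt_toMeromorphicNFOn hm trivial,
      meromorphicOrderAt_mul (hGm z) (hFm z).inv, meromorphicOrderAt_inv,
      (hF.analyticAt z).meromorphicOrderAt_eq, (hG.analyticAt z).meromorphicOrderAt_eq, ← hord z]
    obtain ⟨n, hn⟩ := ENat.ne_top_iff_exists.1 (hfin z)
    rw [← hn]
    simp only [ENat.map_natCast]
    norm_cast
    simp
  have hA : ∀ z, AnalyticAt ℂ h z := fun z =>
    (hNF z).meromorphicOrderAt_nonneg_iff_analyticAt.1 (hord0 z).ge
  refine ⟨h, fun z => (hA z).differentiableAt, fun z => ?_, fun z => ?_⟩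
  · exact (hNF z).meromorphicOrderAt_eq_zero_iff.1 (hord0 z)
  · have hev : ∀ᶠ w in nhdsWithin z {z}ᶜ, G w = F w * h w := by
      have h1 := hm.toMeromorphicNFOn_eq_self_on_nhdsNE (x := z) trivial
      have h2 : ∀ᶠ w in nhdsWithin z {z}ᶜ, F w ≠ 0 := by
        rcases (hF.analyticAt z).eventually_eq_zero_or_eventually_ne_zero with h | h
        · exact absurd (analyticOrderAt_eq_top.2 h) (hfin z)
        · exact h
      filter_upwards [h1, h2] with w hw1 hw2
      rw [hdef, hw1]
      simp only [Pi.mul_apply, Pi.inv_apply]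
      field_simp
    have hc : ContinuousAt (fun w => F w * h w) z := (hF z).continuousAt.mul (hA z).continuousAt
    exact tendsto_nhds_unique ((hG z).continuousAt.tendsto.mono_left nhdsWithin_le_nhds)
      ((hc.tendsto.mono_left nhdsWithin_le_nhds).congr' (hev.mono fun w hw => hw.symm))

open Metric Real Filter Topology Asymptotics in
/-- Hadamard's theorem for quotients: two entire functions of growth `exp (o(r²))` with value `1`
at `0` and zeros of the same orders differ by a factor `exp (c z)`. -/
theorem eq_mul_exp_of_analyticOrderAt_eq {F G : ℂ → ℂ} (hF : Differentiable ℂ F)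
    (hG : Differentiable ℂ G) (F0 : F 0 = 1) (G0 : G 0 = 1)
    (hord : ∀ z, analyticOrderAt F z = analyticOrderAt G z) {φ : ℝ → ℝ}
    (hφ : φ =o[atTop] fun r => r ^ 2) (hφ0 : ∀ r, 0 ≤ r → 0 ≤ φ r)
    (hFφ : ∀ z, ‖F z‖ ≤ Real.exp (φ ‖z‖)) (hGφ : ∀ z, ‖G z‖ ≤ Real.exp (φ ‖z‖)) :
    ∃ c : ℂ, ∀ z, G z = F z * Complex.exp (c * z) := by
  have hFan : AnalyticOnNhd ℂ F Set.univ := fun z _ => hF.analyticAt z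
  have hfin : ∀ z, analyticOrderAt F z ≠ ⊤ := fun z htop => by
    have := hFan.eq_of_eventuallyEq (g := 0) (z₀ := z) (fun _ _ => analyticAt_const)
      (analyticOrderAt_eq_top.1 htop)
    simpa [F0] using congrFun this 0
  obtain ⟨h, hh, hne, hfac⟩ := exists_nonvanishing_factor hF hG hord hfin
  have h0 : h 0 = 1 := by simpa [F0, G0] using (hfac 0).symm
  obtain ⟨q, hq, q0, hexp⟩ := exists_differentiable_exp_eq hh hne h0
  have hlog : ∀ {K : ℂ → ℂ}, (∀ z, ‖K z‖ ≤ Real.exp (φ ‖z‖)) → ∀ R > 0,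
      ∀ z ∈ sphere (0 : ℂ) R, Real.log ‖K z‖ ≤ φ R := by
    intro K hK R hR z hz
    rw [mem_sphere_zero_iff_norm] at hz
    rcases (norm_nonneg (K z)).eq_or_lt with h | h
    · rw [← h, Real.log_zero]; exact hφ0 R hR.le
    · rw [← hz]; exact (Real.log_le_iff_le_exp h).2 (hK z)
  have hint : ∀ {K : ℂ → ℂ}, Differentiable ℂ K → ∀ R : ℝ,
      CircleIntegrable (fun z => Real.log ‖K z‖) 0 R := fun hK R =>
    MeromorphicOn.circleIntegrable_log_norm fun z _ => (hK.analyticAt z).meromorphicAt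
  obtain ⟨c, hc⟩ := eq_mul_of_circleAverage_isLittleO hq q0 (φ := fun r => 4 * φ r)
    (hφ.const_mul_left 4) fun R hR => by
      have hre : ∀ z, (q z).re = Real.log ‖h z‖ := fun z => by
        rw [hexp, Complex.norm_exp, Real.log_exp]
      -- The logarithm of the quotient splits only off the zeros of `F`, an exceptional set that
      -- circle means ignore.
      have hev : (fun z => |Real.log ‖h z‖|) =ᶠ[codiscreteWithin (sphere (0 : ℂ) |R|)]
          fun z => |Real.log ‖G z‖ - Real.log ‖F z‖| := by
        have : ∀ᶠ z in codiscreteWithin (sphere (0 : ℂ) |R|), F z ≠ 0 := by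
          refine codiscreteWithin_mono (Set.subset_univ _) ?_
          refine mem_codiscreteWithin_iff_forall_mem_nhdsNE.2 fun z _ => ?_
          rcases (hF.analyticAt z).eventually_eq_zero_or_eventually_ne_zero with h | h
          · exact absurd (analyticOrderAt_eq_top.2 h) (hfin z)
          · filter_upwards [h] with w hw using Or.inl hw
        filter_upwards [this] with z hz
        rw [hfac z, norm_mul, Real.log_mul (by simpa using hz) (by simpa using hne z)]
        ring_nf
      simp_rw [hre]
      rw [circleAverage_congr_codiscreteWithin hev hR.ne']
      have h1 := circleAverage_abs_log_norm_le hF F0 hR (hlog hFφ R hR) (hφ0 R hR.le)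
      have h2 := circleAverage_abs_log_norm_le hG G0 hR (hlog hGφ R hR) (hφ0 R hR.le)
      have h3 := circleAverage_add (hint hG R).abs (hint hF R).abs
      calc circleAverage (fun z => |Real.log ‖G z‖ - Real.log ‖F z‖|) 0 R
          ≤ circleAverage (fun z => |Real.log ‖G z‖| + |Real.log ‖F z‖|) 0 R :=
            circleAverage_mono ((hint hG R).sub (hint hF R)).abs
              ((hint hG R).abs.add (hint hF R).abs) fun z _ => abs_sub _ _
        _ = _ := h3
        _ ≤ 4 * φ R := by
          change circleAverage (fun z => |Real.log ‖G z‖|) 0 R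
            + circleAverage (fun z => |Real.log ‖F z‖|) 0 R ≤ _
          linarith
  exact ⟨c, fun z => by rw [hfac, hexp, hc]⟩

/-! ### Functions entire along complex lines. -/

section LineEntire

variable {V W U : Type*} [AddCommGroup V] [Module ℂ V] [AddCommGroup W] [Module ℂ W]
  [AddCommGroup U] [Module ℝ U]

/-- Functions on a complex vector space that are entire along every complex line. -/
def LineEntire (G : V → ℂ) : Prop :=
  ∀ a b : V, Differentiable ℂ fun s : ℂ => G (a + s • b)

theorem LineEntire.mul {G H : V → ℂ} (hG : LineEntire G) (hH : LineEntire H) :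
    LineEntire fun z => G z * H z :=
  fun a b => (hG a b).mul (hH a b)

theorem LineEntire.sub {G H : V → ℂ} (hG : LineEntire G) (hH : LineEntire H) :
    LineEntire fun z => G z - H z :=
  fun a b => (hG a b).sub (hH a b)

theorem LineEntire.comp_affine {G : V → ℂ} (hG : LineEntire G) (L : W →ₗ[ℂ] V) (c : V) :
    LineEntire fun z => G (c + L z) := fun a b => by
  simpa [add_assoc] using hG (c + L a) (L b)

theorem LineEntire.comp_linear {G : V → ℂ} (hG : LineEntire G) (L : W →ₗ[ℂ] V) :
    LineEntire fun z => G (L z) := by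
  simpa using hG.comp_affine L 0

theorem LineEntire.differentiable_smul {G : V → ℂ} (hG : LineEntire G) (v : V) :
    Differentiable ℂ fun s : ℂ => G (s • v) := by
  simpa using hG 0 v

open Filter Topology in
/-- An entire function that is not identically zero does not vanish on punctured neighbourhoods. -/
theorem eventually_ne_zero_of_differentiable {F : ℂ → ℂ} (hF : Differentiable ℂ F) {w : ℂ}
    (hw : F w ≠ 0) (z : ℂ) : ∀ᶠ s in 𝓝[≠] z, F s ≠ 0 := by
  rcases (hF.analyticAt z).eventually_eq_zero_or_eventually_ne_zero with h | h
  · have hFan : AnalyticOnNhd ℂ F Set.univ := fun z _ => hF.analyticAt z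
    have := hFan.eq_of_eventuallyEq (g := 0) (z₀ := z) (fun _ _ => analyticAt_const) h
    exact absurd (congrFun this w) hw
  · exact h

open Filter Topology in
theorem tendsto_ofReal_nhdsNE (x : ℝ) :
    Tendsto (fun s : ℝ => (s : ℂ)) (𝓝[≠] x) (𝓝[≠] (x : ℂ)) :=
  tendsto_nhdsWithin_iff.2 ⟨Complex.continuous_ofReal.continuousAt.tendsto.mono_left
    nhdsWithin_le_nhds, eventually_mem_nhdsWithin.mono fun _ hs => by simpa using hs⟩

open Filter Topology in
theorem eq_zero_of_eventually_ofReal {F : ℂ → ℂ} (hF : Differentiable ℂ F)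
    (h : ∀ᶠ s : ℝ in 𝓝 0, F s = 0) (z : ℂ) : F z = 0 := by
  by_contra hz
  have h1 := (tendsto_ofReal_nhdsNE 0).eventually
    (by simpa using eventually_ne_zero_of_differentiable hF hz 0)
  obtain ⟨s, hs1, hs2⟩ := (h1.and (h.filter_mono nhdsWithin_le_nhds)).exists
  exact hs1 hs2

/-- The functions that are entire along lines form an integral domain. -/
theorem LineEntire.exists_mul_ne_zero {G H : V → ℂ} (hG : LineEntire G) (hH : LineEntire H)
    {a b : V} (ha : G a ≠ 0) (hb : H b ≠ 0) : ∃ z, G z ≠ 0 ∧ H z ≠ 0 := by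
  -- On the line through `a` (`s = 0`) and `b` (`s = 1`) neither restriction is null, so both have
  -- isolated zeros.
  have h1 := eventually_ne_zero_of_differentiable (hG a (b - a)) (w := 0) (by simpa using ha) 0
  have h2 := eventually_ne_zero_of_differentiable (hH a (b - a)) (w := 1) (by simpa using hb) 0
  obtain ⟨s, hs⟩ := (h1.and h2).exists
  exact ⟨_, hs⟩

open Filter Topology in
/-- Identity theorem from a neighbourhood of `0` in a totally real subspace. -/
theorem LineEntire.eq_zero_of_eventually {G : V → ℂ} (hG : LineEntire G) [Module ℝ V]
    [IsScalarTower ℝ ℂ V] (ι : U →ₗ[ℝ] V) (hι : ∀ z, ∃ a b, z = ι a + Complex.I • ι b)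
    (h : ∀ a, ∀ᶠ s : ℝ in 𝓝 0, G (ι (s • a)) = 0) (z : V) : G z = 0 := by
  have hsm : ∀ (s : ℝ) (a : U), ι (s • a) = (s : ℂ) • ι a := fun s a => by
    rw [map_smul]
    exact (algebraMap_smul ℂ s (ι a)).symm
  have hreal : ∀ a, G (ι a) = 0 := fun a => by
    have := eq_zero_of_eventually_ofReal (hG.differentiable_smul (ι a))
      ((h a).mono fun s hs => by rwa [hsm] at hs) 1
    simpa using this
  obtain ⟨a, b, rfl⟩ := hι z
  -- The line `ι a + s • ι b` lies in the real subspace for real `s` and reaches the given point at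
  -- `s = I`.
  refine eq_zero_of_eventually_ofReal (hG (ι a) (ι b)) (Eventually.of_forall fun s => ?_) Complex.I
  rw [← hsm, ← map_add]
  exact hreal _

open Filter Topology in
/-- A continuous identity on a real subspace may be checked off the zeros of a non-null function
that is entire along lines. -/
theorem LineEntire.eq_of_forall_ne_zero {G : V → ℂ} (hG : LineEntire G) (h0 : G 0 ≠ 0)
    [Module ℝ V] [IsScalarTower ℝ ℂ V] [TopologicalSpace U] [ContinuousSMul ℝ U]
    (ι : U →ₗ[ℝ] V) {p q : U → ℂ} (hp : Continuous p) (hq : Continuous q)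
    (h : ∀ u, G (ι u) ≠ 0 → p u = q u) : p = q := by
  funext u
  have h1 := (tendsto_ofReal_nhdsNE 1).eventually (eventually_ne_zero_of_differentiable
    (hG.differentiable_smul (ι u)) (w := 0) (by simpa using h0) (1 : ℝ))
  have hev : ∀ᶠ s : ℝ in 𝓝[≠] 1, p (s • u) = q (s • u) := by
    filter_upwards [h1] with s hs
    refine h _ ?_
    rw [map_smul]
    exact (algebraMap_smul ℂ s (ι u)) ▸ hs
  have hcp : Tendsto (fun s : ℝ => p (s • u)) (𝓝[≠] 1) (𝓝 (p ((1 : ℝ) • u))) :=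
    ((by fun_prop : Continuous fun s : ℝ => p (s • u)).tendsto 1).mono_left nhdsWithin_le_nhds
  have hcq : Tendsto (fun s : ℝ => q (s • u)) (𝓝[≠] 1) (𝓝 (q ((1 : ℝ) • u))) :=
    ((by fun_prop : Continuous fun s : ℝ => q (s • u)).tendsto 1).mono_left nhdsWithin_le_nhds
  simpa using tendsto_nhds_unique (hcp.congr' hev) hcq

/-- Orders add under products, and `K` contributes zero at `t`; hence `ord G = ord H + ord F`. -/
theorem analyticOrderAt_le_of_mul_eq_mul {F G K H : ℂ → ℂ} {t : ℂ} (hF : Differentiable ℂ F)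
    (hG : Differentiable ℂ G) (hK : Differentiable ℂ K) (hH : Differentiable ℂ H)
    (h : ∀ s, H s * F s = K s * G s) (hKt : K t ≠ 0) :
    analyticOrderAt F t ≤ analyticOrderAt G t := by
  have e : H * F = K * G := funext h
  have h1 := analyticOrderAt_mul (hH.analyticAt t) (hF.analyticAt t)
  rw [e, analyticOrderAt_mul (hK.analyticAt t) (hG.analyticAt t),
    (hK.analyticAt t).analyticOrderAt_eq_zero.2 hKt, zero_add] at h1
  rw [h1]
  exact le_add_self

/-- Comparison of the zeros of two functions along lines, when the two functions are the marginals
of two functions linked by a product identity and the second one is not null on slices. -/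
theorem analyticOrderAt_line_le {Φ Φ' : V × V → ℂ} {f f' : V → ℂ} (hΦ : LineEntire Φ)
    (hΦ' : LineEntire Φ') (hf : LineEntire f) (hf' : LineEntire f') (hf'0 : f' 0 ≠ 0)
    (key : ∀ z₁ z₂, Φ' (z₁, z₂) * (f z₁ * f z₂) = Φ (z₁, z₂) * (f' z₁ * f' z₂))
    (hne : ∀ z₀, (∃ z, Φ (z₀, z) ≠ 0) ∨ ∃ z, Φ (z, z₀) ≠ 0) (v : V) (t : ℂ) :
    analyticOrderAt (fun s : ℂ => f (s • v)) t ≤ analyticOrderAt (fun s : ℂ => f' (s • v)) t := by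
  have slice₁ : ∀ {Ψ : V × V → ℂ}, LineEntire Ψ → ∀ w, LineEntire fun z => Ψ (z, w) :=
    fun hΨ w => by simpa using hΨ.comp_affine (LinearMap.inl ℂ V V) (0, w)
  have slice₂ : ∀ {Ψ : V × V → ℂ}, LineEntire Ψ → ∀ w, LineEntire fun z => Ψ (w, z) :=
    fun hΨ w => by simpa using hΨ.comp_affine (LinearMap.inr ℂ V V) (w, 0)
  rcases hne (t • v) with ⟨z, hz⟩ | ⟨z, hz⟩
  -- H1 gives a point where the slice is nonzero; it is moved to `w` so that `f' w ≠ 0` as well.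
  · obtain ⟨w, hw1, hw2⟩ := (slice₂ hΦ (t • v)).exists_mul_ne_zero hf' hz hf'0
    refine analyticOrderAt_le_of_mul_eq_mul (K := fun s => Φ (s • v, w) * f' w)
      (H := fun s => Φ' (s • v, w) * f w) (hf.differentiable_smul v) (hf'.differentiable_smul v)
      (((slice₁ hΦ w).differentiable_smul v).mul_const _)
      (((slice₁ hΦ' w).differentiable_smul v).mul_const _) (fun s => ?_) (mul_ne_zero hw1 hw2)
    linear_combination key (s • v) w
  · obtain ⟨w, hw1, hw2⟩ := (slice₁ hΦ (t • v)).exists_mul_ne_zero hf' hz hf'0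
    refine analyticOrderAt_le_of_mul_eq_mul (K := fun s => Φ (w, s • v) * f' w)
      (H := fun s => Φ' (w, s • v) * f w) (hf.differentiable_smul v) (hf'.differentiable_smul v)
      (((slice₂ hΦ w).differentiable_smul v).mul_const _)
      (((slice₂ hΦ' w).differentiable_smul v).mul_const _) (fun s => ?_) (mul_ne_zero hw1 hw2)
    linear_combination key w (s • v)

end LineEntire

/-! ### Laplace transforms: derivatives, moments, uniqueness. -/

/-- Differentiation of `s ↦ ∫ exp (p + s q)` under the integral sign. -/
theorem hasDerivAt_integral_cexp_add_mul {X : Type*} [MeasurableSpace X] {ν : Measure X}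
    {p q : X → ℂ} (hp : Measurable p) (hq : Measurable q)
    (hint : ∀ C : ℝ, Integrable (fun x => Real.exp (C * (‖p x‖ + ‖q x‖))) ν) (s₀ : ℂ) :
    HasDerivAt (fun s => ∫ x, Complex.exp (p x + s * q x) ∂ν)
      (∫ x, Complex.exp (p x + s₀ * q x) * q x ∂ν) s₀ := by
  refine (hasDerivAt_integral_of_dominated_loc_of_deriv_le (Metric.ball_mem_nhds s₀ one_pos)
    (F := fun s x => Complex.exp (p x + s * q x))
    (F' := fun s x => Complex.exp (p x + s * q x) * q x)
    (Filter.Eventually.of_forall fun s => Measurable.aestronglyMeasurable (by fun_prop)) ?_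
    (Measurable.aestronglyMeasurable (by fun_prop))
    -- On the unit ball `‖s‖ ≤ ‖s₀‖ + 1`; one more unit absorbs the factor `‖q x‖ ≤ exp ‖q x‖`.
    (bound := fun x => Real.exp ((‖s₀‖ + 2) * (‖p x‖ + ‖q x‖))) ?_ (hint _) ?_).2
  · refine (hint (‖s₀‖ + 1)).mono' (by fun_prop) (Filter.Eventually.of_forall fun x => ?_)
    rw [Complex.norm_exp]
    refine Real.exp_le_exp.2 ((Complex.re_le_norm _).trans ((norm_add_le _ _).trans ?_))
    rw [norm_mul]
    nlinarith [norm_nonneg s₀, norm_nonneg (p x), norm_nonneg (q x),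
      mul_nonneg (norm_nonneg s₀) (norm_nonneg (p x))]
  · refine Filter.Eventually.of_forall fun x s hs => ?_
    have hs' : ‖s‖ ≤ ‖s₀‖ + 1 := by
      have := norm_add_le (s - s₀) s₀
      rw [sub_add_cancel] at this
      rw [mem_ball_iff_norm] at hs
      linarith
    rw [norm_mul, Complex.norm_exp]
    have h1 : ‖q x‖ ≤ Real.exp ‖q x‖ := by linarith [Real.add_one_le_exp ‖q x‖]
    have h2 : (p x + s * q x).re ≤ ‖p x‖ + (‖s₀‖ + 1) * ‖q x‖ := by
      refine (Complex.re_le_norm _).trans ((norm_add_le _ _).trans ?_)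
      rw [norm_mul]
      gcongr
    calc Real.exp (p x + s * q x).re * ‖q x‖
        ≤ Real.exp (‖p x‖ + (‖s₀‖ + 1) * ‖q x‖) * Real.exp ‖q x‖ := by gcongr
      _ ≤ _ := by
        rw [← Real.exp_add]
        refine Real.exp_le_exp.2 ?_
        nlinarith [norm_nonneg s₀, norm_nonneg (p x), norm_nonneg (q x),
          mul_nonneg (norm_nonneg s₀) (norm_nonneg (p x))]
  · refine Filter.Eventually.of_forall fun x s _ => ?_
    simpa using (((hasDerivAt_id s).mul_const (q x)).const_add (p x)).cexp

variable {d : ℕ}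

/-- The embedding `t ↦ i t` of `ℝ^d` into `ℂ^d`. -/
noncomputable def imagVec (d : ℕ) : EuclideanSpace ℝ (Fin d) →ₗ[ℝ] (Fin d → ℂ) where
  toFun t j := Complex.I * (t j : ℂ)
  map_add' s t := by ext j; simp [mul_add]
  map_smul' c t := by ext j; simp; ring

/-- A real vector, seen in `ℂ^d`. -/
def realVec (v : EuclideanSpace ℝ (Fin d)) : Fin d → ℂ := fun j => (v j : ℂ)

theorem I_smul_realVec (v : EuclideanSpace ℝ (Fin d)) :
    Complex.I • realVec v = imagVec d v := by
  ext j; simp [realVec, imagVec]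

theorem exists_eq_imagVec_add (z : Fin d → ℂ) :
    ∃ a b, z = imagVec d a + Complex.I • imagVec d b := by
  refine ⟨WithLp.toLp 2 fun j => (z j).im, WithLp.toLp 2 fun j => -(z j).re, ?_⟩
  ext j
  apply Complex.ext <;> simp [imagVec]

theorem cdot_add_left (z w : Fin d → ℂ) (x : EuclideanSpace ℝ (Fin d)) :
    cdot (z + w) x = cdot z x + cdot w x := by
  simp [cdot, add_mul, Finset.sum_add_distrib]

theorem cdot_smul_left (s : ℂ) (z : Fin d → ℂ) (x : EuclideanSpace ℝ (Fin d)) :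
    cdot (s • z) x = s * cdot z x := by
  simp [cdot, Finset.mul_sum, mul_assoc]

@[simp] theorem cdot_zero_left (x : EuclideanSpace ℝ (Fin d)) : cdot 0 x = 0 := by
  simp [cdot]

theorem cdot_add_right (z : Fin d → ℂ) (x y : EuclideanSpace ℝ (Fin d)) :
    cdot z (x + y) = cdot z x + cdot z y := by
  simp [cdot, mul_add, Finset.sum_add_distrib]

theorem cdot_sub_right (z : Fin d → ℂ) (x y : EuclideanSpace ℝ (Fin d)) :
    cdot z (x - y) = cdot z x - cdot z y := by
  simp [cdot, mul_sub, Finset.sum_sub_distrib]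

theorem cdot_realVec (v x : EuclideanSpace ℝ (Fin d)) :
    cdot (realVec v) x = (inner ℝ v x : ℝ) := by
  simp [cdot, realVec, PiLp.inner_apply, mul_comm]

theorem cdot_imagVec (t x : EuclideanSpace ℝ (Fin d)) :
    cdot (imagVec d t) x = (inner ℝ x t : ℝ) * Complex.I := by
  rw [← I_smul_realVec, cdot_smul_left, cdot_realVec, real_inner_comm, mul_comm]

theorem norm_cdot_le (z : Fin d → ℂ) (x : EuclideanSpace ℝ (Fin d)) :
    ‖cdot z x‖ ≤ (∑ j, ‖z j‖) * ‖x‖ := by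
  rw [cdot, Finset.sum_mul]
  refine norm_sum_le_of_le _ fun j _ => ?_
  rw [norm_mul, Complex.norm_real]
  gcongr
  exact PiLp.norm_apply_le x j

@[fun_prop]
theorem continuous_cdot (z : Fin d → ℂ) : Continuous (cdot z) := by
  unfold cdot; fun_prop

theorem measurable_cdot (z : Fin d → ℂ) : Measurable (cdot z) :=
  (continuous_cdot z).measurable

/-- A measure with a finite Laplace transform has exponential moments of the norm. -/
theorem integrable_exp_norm {ν : Measure (EuclideanSpace ℝ (Fin d))} [IsFiniteMeasure ν]
    (h : ∀ u : EuclideanSpace ℝ (Fin d), Integrable (fun x => Real.exp (inner ℝ u x)) ν) (C : ℝ) :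
    Integrable (fun x => Real.exp (C * ‖x‖)) ν := by
  -- As `‖x‖ ≤ d * max |x j|`, the exponential is dominated by those of `±⟨u j, x⟩` for a largest
  -- coordinate; the constant `1` in the bound serves `d = 0`.
  let u : Fin d → EuclideanSpace ℝ (Fin d) := fun j => EuclideanSpace.single j (|C| * d)
  have hb : Integrable (fun x => 1 + ∑ j, (Real.exp (inner ℝ (u j) x)
      + Real.exp (inner ℝ (-u j) x))) ν :=
    (integrable_const _).add (integrable_finsetSum _ fun j _ => (h _).add (h _))
  refine hb.mono' (Measurable.aestronglyMeasurable (by fun_prop))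
    (Filter.Eventually.of_forall fun x => ?_)
  rw [Real.norm_eq_abs, Real.abs_exp]
  have hnorm : ‖x‖ ≤ ∑ j, |x j| := by
    conv_lhs => rw [← (EuclideanSpace.basisFun (Fin d) ℝ).sum_repr x]
    refine norm_sum_le_of_le _ fun j _ => ?_
    simp [norm_smul]
  have hpos : 0 ≤ ∑ j, (Real.exp (inner ℝ (u j) x) + Real.exp (inner ℝ (-u j) x)) :=
    Finset.sum_nonneg fun j _ => by positivity
  rcases isEmpty_or_nonempty (Fin d) with hd | hd
  · have : ‖x‖ = 0 := le_antisymm (by simpa using hnorm) (norm_nonneg x)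
    simp [this]
  · obtain ⟨j, -, hj⟩ := Finset.exists_max_image Finset.univ (fun j => |x j|)
      Finset.univ_nonempty
    have hsum : ∑ j, |x j| ≤ d * |x j| := by
      simpa using Finset.sum_le_card_nsmul Finset.univ (fun j => |x j|) _ hj
    have h1 : C * ‖x‖ ≤ |C| * d * |x j| := by
      calc C * ‖x‖ ≤ |C| * (d * |x j|) :=
            mul_le_mul (le_abs_self C) (hnorm.trans hsum) (norm_nonneg x) (abs_nonneg C)
        _ = _ := by ring
    have hu : (inner ℝ (u j) x : ℝ) = |C| * d * x j := by
      simp [u, EuclideanSpace.inner_single_left]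
    have h2 : Real.exp (|C| * d * |x j|)
        ≤ Real.exp (inner ℝ (u j) x) + Real.exp (inner ℝ (-u j) x) := by
      rw [inner_neg_left, hu]
      rcases abs_cases (x j) with ⟨e, -⟩ | ⟨e, -⟩ <;> rw [e]
      · linarith [Real.exp_pos (-(|C| * d * x j))]
      · rw [mul_neg]
        linarith [Real.exp_pos (|C| * d * x j)]
    have h3 := Finset.single_le_sum (s := Finset.univ)
      (f := fun j => Real.exp (inner ℝ (u j) x) + Real.exp (inner ℝ (-u j) x))
      (fun j _ => by positivity) (Finset.mem_univ j)
    have h4 := Real.exp_le_exp.2 h1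
    linarith

/-- Finiteness of all exponential moments of a law on `ℝ^d × ℝ^d`. -/
def HasExpMoments (R : Measure (EuclideanSpace ℝ (Fin d) × EuclideanSpace ℝ (Fin d))) : Prop :=
  ∀ C : ℝ, Integrable (fun x => Real.exp (C * (‖x.1‖ + ‖x.2‖))) R

section Moments

variable {R R' : Measure (EuclideanSpace ℝ (Fin d) × EuclideanSpace ℝ (Fin d))}

/-- Since `ab ≤ a² + b²`, joint exponential moments at `C` reduce to marginal ones at `2 C`,
whatever the dependence. -/
theorem hasExpMoments_of_map {ν : Measure (EuclideanSpace ℝ (Fin d))} [IsFiniteMeasure ν]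
    (h1 : R.map Prod.fst = ν) (h2 : R.map Prod.snd = ν)
    (h : ∀ u : EuclideanSpace ℝ (Fin d), Integrable (fun x => Real.exp (inner ℝ u x)) ν) :
    HasExpMoments R := by
  intro C
  have hν := integrable_exp_norm h (2 * C)
  have i1 : Integrable (fun x => Real.exp (2 * C * ‖x.1‖)) R :=
    (h1 ▸ hν).comp_measurable measurable_fst
  have i2 : Integrable (fun x => Real.exp (2 * C * ‖x.2‖)) R :=
    (h2 ▸ hν).comp_measurable measurable_snd
  refine (i1.add i2).mono' (Measurable.aestronglyMeasurable (by fun_prop))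
    (Filter.Eventually.of_forall fun x => ?_)
  rw [Real.norm_eq_abs, Real.abs_exp, mul_add, Real.exp_add, Pi.add_apply]
  have e : ∀ y, Real.exp (2 * C * y) = Real.exp (C * y) ^ 2 := fun y => by
    rw [← Real.exp_nat_mul]; push_cast; ring_nf
  rw [e, e]
  nlinarith [sq_nonneg (Real.exp (C * ‖x.1‖) - Real.exp (C * ‖x.2‖)),
    sq_nonneg (Real.exp (C * ‖x.1‖)), sq_nonneg (Real.exp (C * ‖x.2‖))]

theorem HasExpMoments.hasDerivAt_Phi (hR : HasExpMoments R) (a b : (Fin d → ℂ) × (Fin d → ℂ))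
    (s₀ : ℂ) :
    HasDerivAt (fun s : ℂ => Phi R (a.1 + s • b.1) (a.2 + s • b.2))
      (∫ x, Complex.exp (cdot a.1 x.1 + cdot a.2 x.2 + s₀ * (cdot b.1 x.1 + cdot b.2 x.2))
        * (cdot b.1 x.1 + cdot b.2 x.2) ∂ R) s₀ := by
  have hm : ∀ c : (Fin d → ℂ) × (Fin d → ℂ), Measurable fun x : EuclideanSpace ℝ (Fin d) ×
      EuclideanSpace ℝ (Fin d) => cdot c.1 x.1 + cdot c.2 x.2 := fun c =>
    ((measurable_cdot _).comp measurable_fst).add ((measurable_cdot _).comp measurable_snd)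
  have hle : ∀ c : (Fin d → ℂ) × (Fin d → ℂ), ∃ K, 0 ≤ K ∧ ∀ x : EuclideanSpace ℝ (Fin d) ×
      EuclideanSpace ℝ (Fin d), ‖cdot c.1 x.1 + cdot c.2 x.2‖ ≤ K * (‖x.1‖ + ‖x.2‖) := fun c => by
    have h1 : 0 ≤ ∑ j, ‖c.1 j‖ := Finset.sum_nonneg fun _ _ => norm_nonneg _
    have h2 : 0 ≤ ∑ j, ‖c.2 j‖ := Finset.sum_nonneg fun _ _ => norm_nonneg _
    refine ⟨∑ j, ‖c.1 j‖ + ∑ j, ‖c.2 j‖, add_nonneg h1 h2, fun x => ?_⟩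
    have h3 := norm_cdot_le c.1 x.1
    have h4 := norm_cdot_le c.2 x.2
    refine (norm_add_le _ _).trans ?_
    nlinarith [mul_nonneg h1 (norm_nonneg x.2), mul_nonneg h2 (norm_nonneg x.1)]
  have key := hasDerivAt_integral_cexp_add_mul (ν := R) (hm a) (hm b) (fun C => ?_) s₀
  · refine key.congr_of_eventuallyEq (Filter.Eventually.of_forall fun s => ?_)
    refine integral_congr_ae (Filter.Eventually.of_forall fun x => ?_)
    simp only [cdot_add_left, cdot_smul_left]
    ring_nf
  · obtain ⟨K₁, -, h1⟩ := hle a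
    obtain ⟨K₂, -, h2⟩ := hle b
    refine (hR (|C| * (K₁ + K₂))).mono' (Measurable.aestronglyMeasurable ?_)
      (Filter.Eventually.of_forall fun x => ?_)
    · exact Real.measurable_exp.comp (measurable_const.mul ((hm a).norm.add (hm b).norm))
    · rw [Real.norm_eq_abs, Real.abs_exp, Real.exp_le_exp, mul_assoc, add_mul]
      exact mul_le_mul (le_abs_self C) (add_le_add (h1 x) (h2 x)) (by positivity) (abs_nonneg C)

theorem HasExpMoments.lineEntire_Phi (hR : HasExpMoments R) :
    LineEntire fun z : (Fin d → ℂ) × (Fin d → ℂ) => Phi R z.1 z.2 :=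
  fun a b s => (hR.hasDerivAt_Phi a b s).differentiableAt

theorem HasExpMoments.lineEntire_Phi_left (hR : HasExpMoments R) :
    LineEntire fun z => Phi R z 0 := by
  simpa using hR.lineEntire_Phi.comp_linear (LinearMap.inl ℂ _ _)

theorem HasExpMoments.integrable_fst (hR : HasExpMoments R) : Integrable (fun x => x.1) R := by
  refine (hR 1).mono' measurable_fst.aestronglyMeasurable (Filter.Eventually.of_forall fun x => ?_)
  rw [one_mul]
  linarith [Real.add_one_le_exp (‖x.1‖ + ‖x.2‖), norm_nonneg x.2]

/-- This reads the mean off the transform and later determines the constant in Hadamard's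
exponential factor. -/
theorem HasExpMoments.hasDerivAt_Phi_zero (hR : HasExpMoments R) (v : EuclideanSpace ℝ (Fin d)) :
    HasDerivAt (fun s : ℂ => Phi R (s • realVec v) 0) (inner ℝ v (∫ x, x.1 ∂ R) : ℝ) 0 := by
  have := hR.hasDerivAt_Phi 0 (realVec v, 0) 0
  simp only [Prod.fst_zero, Prod.snd_zero, zero_add, smul_zero, cdot_zero_left, add_zero, zero_mul,
    Complex.exp_zero, one_mul, cdot_realVec] at this
  rwa [integral_complex_ofReal, integral_inner hR.integrable_fst] at this

/-- For a real direction `v` the modulus of the integrand is `exp (s.re * ⟨v, x⟩)`, so the tail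
assumption controls the whole complex line. -/
theorem norm_Phi_left_le {A B ρ : ℝ}
    (h : ∀ u : EuclideanSpace ℝ (Fin d),
      ∫ x, Real.exp (inner ℝ u x) ∂ (R.map Prod.fst) ≤ A * Real.exp (B * ‖u‖ ^ ρ))
    (v : EuclideanSpace ℝ (Fin d)) (s : ℂ) :
    ‖Phi R (s • realVec v) 0‖ ≤ A * Real.exp (B * (|s.re| * ‖v‖) ^ ρ) := by
  have h1 := h (s.re • v)
  rw [norm_smul, Real.norm_eq_abs] at h1
  refine le_trans ?_ h1
  rw [integral_map (by fun_prop) (Measurable.aestronglyMeasurable (by fun_prop))]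
  refine (norm_integral_le_integral_norm _).trans_eq ?_
  refine integral_congr_ae (Filter.Eventually.of_forall fun x => ?_)
  simp [Complex.norm_exp, cdot_smul_left, cdot_realVec, inner_smul_left]

theorem Phi_zero_zero [IsProbabilityMeasure R] : Phi R 0 0 = 1 := by
  simp [Phi]

theorem Phi_map_sub (m : EuclideanSpace ℝ (Fin d)) (z₁ z₂ : Fin d → ℂ) :
    Phi (R.map fun x => (x.1 - m, x.2 - m)) z₁ z₂
      = Phi R z₁ z₂ * Complex.exp (-(cdot z₁ m + cdot z₂ m)) := by
  rw [Phi, integral_map (by fun_prop) (Continuous.aestronglyMeasurable (by fun_prop)), Phi,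
    ← integral_mul_const]
  refine integral_congr_ae (Filter.Eventually.of_forall fun x => ?_)
  simp only [← Complex.exp_add, cdot_sub_right]
  ring_nf

theorem HasExpMoments.map_sub [IsFiniteMeasure R] (hR : HasExpMoments R)
    (m : EuclideanSpace ℝ (Fin d)) : HasExpMoments (R.map fun x => (x.1 - m, x.2 - m)) := by
  intro C
  rw [integrable_map_measure (Continuous.aestronglyMeasurable (by fun_prop)) (by fun_prop)]
  refine ((hR |C|).mul_const (Real.exp (|C| * (2 * ‖m‖)))).mono'
    (Continuous.aestronglyMeasurable (by simp only [Function.comp_def]; fun_prop))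
    (Filter.Eventually.of_forall fun x => ?_)
  rw [Real.norm_eq_abs, Function.comp_apply, Real.abs_exp, ← Real.exp_add, Real.exp_le_exp,
    ← mul_add]
  refine mul_le_mul (le_abs_self C) ?_ (by positivity) (abs_nonneg C)
  linarith [norm_sub_le x.1 m, norm_sub_le x.2 m]

/-- A finite measure on `ℝ^d × ℝ^d` is determined by `Φ` on the imaginary subspace. -/
theorem eq_of_Phi_imagVec_eq [IsFiniteMeasure R] [IsFiniteMeasure R']
    (h : ∀ t₁ t₂, Phi R (imagVec d t₁) (imagVec d t₂) = Phi R' (imagVec d t₁) (imagVec d t₂)) :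
    R = R' := by
  refine Measure.ext_of_charFunDual ?_
  ext L
  obtain ⟨t₁, h1⟩ := (InnerProductSpace.toDual ℝ _).surjective
    (L.comp (ContinuousLinearMap.inl ℝ _ _))
  obtain ⟨t₂, h2⟩ := (InnerProductSpace.toDual ℝ _).surjective
    (L.comp (ContinuousLinearMap.inr ℝ _ _))
  have hL : ∀ x : EuclideanSpace ℝ (Fin d) × EuclideanSpace ℝ (Fin d),
      (L x : ℂ) * Complex.I = cdot (imagVec d t₁) x.1 + cdot (imagVec d t₂) x.2 := fun x => by
    have e1 := DFunLike.congr_fun h1 x.1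
    have e2 := DFunLike.congr_fun h2 x.2
    simp only [InnerProductSpace.toDual_apply_apply, ContinuousLinearMap.comp_apply,
      ContinuousLinearMap.inl_apply, ContinuousLinearMap.inr_apply] at e1 e2
    rw [cdot_imagVec, cdot_imagVec, real_inner_comm, e1, real_inner_comm, e2, ← add_mul,
      ← Complex.ofReal_add, ← map_add]
    simp
  simp only [charFunDual_apply, hL]
  exact h t₁ t₂

end Moments

theorem charFun_eq_integral_cdot (P : Measure (EuclideanSpace ℝ (Fin d)))
    (t : EuclideanSpace ℝ (Fin d)) :
    charFun P t = ∫ x, Complex.exp (cdot (imagVec d t) x) ∂P := by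
  simp only [charFun_apply, cdot_imagVec]

open Filter Topology in
/-- Identity theorem on `ℂ^d × ℂ^d` from a neighbourhood of `0` in the imaginary subspace. -/
theorem LineEntire.eq_zero_of_imagVec {G : (Fin d → ℂ) × (Fin d → ℂ) → ℂ} (hG : LineEntire G)
    (h : ∀ t₁ t₂, ∀ᶠ s : ℝ in 𝓝 0, G (imagVec d (s • t₁), imagVec d (s • t₂)) = 0)
    (z : (Fin d → ℂ) × (Fin d → ℂ)) : G z = 0 := by
  refine hG.eq_zero_of_eventually ((imagVec d).prodMap (imagVec d)) (fun z => ?_)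
    (fun a => h a.1 a.2) z
  obtain ⟨a, b, h1⟩ := exists_eq_imagVec_add z.1
  obtain ⟨a', b', h2⟩ := exists_eq_imagVec_add z.2
  exact ⟨(a, a'), (b, b'), Prod.ext h1 h2⟩

theorem HasExpMoments.lineEntire_Phi_mul
    {Q : Measure (EuclideanSpace ℝ (Fin d) × EuclideanSpace ℝ (Fin d))} (hQ : HasExpMoments Q) :
    LineEntire fun z : (Fin d → ℂ) × (Fin d → ℂ) => Phi Q z.1 0 * Phi Q z.2 0 := by
  have h1 : LineEntire fun z : (Fin d → ℂ) × (Fin d → ℂ) => Phi Q z.1 0 := by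
    simpa only [LinearMap.fst_apply] using
      hQ.lineEntire_Phi_left.comp_linear (LinearMap.fst ℂ _ (Fin d → ℂ))
  have h2 : LineEntire fun z : (Fin d → ℂ) × (Fin d → ℂ) => Phi Q z.2 0 := by
    simpa only [LinearMap.snd_apply] using
      hQ.lineEntire_Phi_left.comp_linear (LinearMap.snd ℂ (Fin d → ℂ) _)
  exact h1.mul h2

/-! ### Identification of signal and noise from the transform. -/

section Identification

variable {R R' : Measure (EuclideanSpace ℝ (Fin d) × EuclideanSpace ℝ (Fin d))}
  [IsProbabilityMeasure R] [IsProbabilityMeasure R']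

/-- The tail assumption bears on the first marginal; equality of marginals, supplied by
stationarity, carries it to the second. -/
theorem HasExpMoments.of_mClass
    {R : Measure (EuclideanSpace ℝ (Fin d) × EuclideanSpace ℝ (Fin d))}
    (h : R.map Prod.snd = R.map Prod.fst) {ρ : ℝ}
    (hρ : R.map Prod.fst ∈ MClass d ρ) : HasExpMoments R := by
  obtain ⟨_, A, B, -, -, hAB⟩ := hρ
  exact hasExpMoments_of_map rfl h fun u => (hAB u).1

open Filter Asymptotics in
theorem isLittleO_rpow_sq {ρ : ℝ} (hρ : ρ < 2) :
    (fun r : ℝ => r ^ ρ) =o[atTop] fun r => r ^ 2 := by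
  refine (isLittleO_iff_tendsto' ?_).2 ?_
  · filter_upwards [eventually_gt_atTop 0] with r hr h
    exact absurd h (by positivity)
  · refine (tendsto_rpow_neg_atTop (y := 2 - ρ) (by linarith)).congr' ?_
    filter_upwards [eventually_gt_atTop 0] with r hr
    rw [neg_sub, Real.rpow_sub hr, Real.rpow_two]

open Filter Asymptotics in
/-- Growth of order less than two of the Laplace transform of the first marginal on the complex line
through a real vector. -/
theorem exists_norm_Phi_left_le_exp
    {R : Measure (EuclideanSpace ℝ (Fin d) × EuclideanSpace ℝ (Fin d))} {ρ : ℝ} (hρ0 : 0 < ρ)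
    (hρ2 : ρ < 2) (hρ : R.map Prod.fst ∈ MClass d ρ) (v : EuclideanSpace ℝ (Fin d)) :
    ∃ φ : ℝ → ℝ, φ =o[atTop] (fun r => r ^ 2) ∧ (∀ r, 0 ≤ r → 0 ≤ φ r) ∧
      ∀ s : ℂ, ‖Phi R (s • realVec v) 0‖ ≤ Real.exp (φ ‖s‖) := by
  obtain ⟨_, A, B, hA, hB, hAB⟩ := hρ
  -- `1 + A` in place of `A` keeps the exponent nonnegative when `A < 1`.
  refine ⟨fun r => Real.log (1 + A) + B * ‖v‖ ^ ρ * r ^ ρ, ?_, fun r hr => ?_, fun s => ?_⟩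
  · refine IsLittleO.add ?_ (IsLittleO.const_mul_left (isLittleO_rpow_sq hρ2) _)
    exact isLittleO_const_left.2 (Or.inr
      (tendsto_norm_atTop_atTop.comp (tendsto_pow_atTop two_ne_zero)))
  · have := Real.log_nonneg (by linarith : 1 ≤ 1 + A)
    have := Real.rpow_nonneg hr ρ
    positivity
  · refine (norm_Phi_left_le (fun u => (hAB u).2) v s).trans ?_
    rw [Real.exp_add, Real.exp_log (by linarith)]
    refine mul_le_mul (by linarith) (Real.exp_le_exp.2 ?_) (Real.exp_pos _).le (by linarith)
    rw [mul_assoc, ← Real.mul_rpow (norm_nonneg _) (norm_nonneg _)]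
    refine mul_le_mul_of_nonneg_left (Real.rpow_le_rpow (by positivity) ?_ hρ0.le) hB.le
    rw [mul_comm]
    exact mul_le_mul_of_nonneg_left (Complex.abs_re_le_norm s) (norm_nonneg v)

theorem H1.exists_ne
    {R : Measure (EuclideanSpace ℝ (Fin d) × EuclideanSpace ℝ (Fin d))} (h : H1 R) (z₀ : Fin d → ℂ) :
    (∃ z, Phi R z₀ z ≠ 0) ∨ ∃ z, Phi R z z₀ ≠ 0 :=
  (h z₀).imp Function.ne_iff.1 Function.ne_iff.1

variable {p p' : EuclideanSpace ℝ (Fin d) → ℂ}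

open Filter Topology in
/-- Elimination of the noise: an identity between the laws of the signals only. -/
theorem Phi_mul_marginals_eq
    {R R' : Measure (EuclideanSpace ℝ (Fin d) × EuclideanSpace ℝ (Fin d))}
    (hR : HasExpMoments R) (hR' : HasExpMoments R')
    (hp0 : p 0 = 1) (hp'0 : p' 0 = 1) (hp' : Continuous p')
    (hpp : ∀ t₁ t₂, Phi R (imagVec d t₁) (imagVec d t₂) * (p t₁ * p t₂)
      = Phi R' (imagVec d t₁) (imagVec d t₂) * (p' t₁ * p' t₂)) (z₁ z₂ : Fin d → ℂ) :
    Phi R' z₁ z₂ * (Phi R z₁ 0 * Phi R z₂ 0) = Phi R z₁ z₂ * (Phi R' z₁ 0 * Phi R' z₂ 0) := by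
  have hA : ∀ t, Phi R (imagVec d t) 0 * p t = Phi R' (imagVec d t) 0 * p' t := fun t => by
    simpa [hp0, hp'0] using hpp t 0
  have hG := (hR'.lineEntire_Phi.mul hR.lineEntire_Phi_mul).sub
    (hR.lineEntire_Phi.mul hR'.lineEntire_Phi_mul)
  refine sub_eq_zero.1 (hG.eq_zero_of_imagVec (fun t₁ t₂ => ?_) (z₁, z₂))
  -- The noise transform may vanish far from `0`, but an identity near `0` on each ray suffices.
  have hne : ∀ t, ∀ᶠ s : ℝ in 𝓝 0, p' (s • t) ≠ 0 := fun t => by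
    have hc : Continuous fun s : ℝ => p' (s • t) := by fun_prop
    exact hc.continuousAt.eventually_ne (by simp [hp'0])
  filter_upwards [hne t₁, hne t₂] with s h1 h2
  have e := hpp (s • t₁) (s • t₂)
  have e1 := hA (s • t₁)
  have e2 := hA (s • t₂)
  refine (mul_eq_zero.1 ?_).resolve_right (mul_ne_zero h1 h2)
  generalize Phi R (imagVec d (s • t₁)) (imagVec d (s • t₂)) = x at *
  generalize Phi R' (imagVec d (s • t₁)) (imagVec d (s • t₂)) = x' at *
  generalize Phi R (imagVec d (s • t₁)) 0 = a at *
  generalize Phi R' (imagVec d (s • t₁)) 0 = a' at *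
  generalize Phi R (imagVec d (s • t₂)) 0 = b at *
  generalize Phi R' (imagVec d (s • t₂)) 0 = b' at *
  linear_combination (-a * b) * e + x * p (s • t₂) * b * e1 + x * p' (s • t₁) * a' * e2

open Asymptotics Filter in
/-- The marginals agree up to the translation by the difference of the means. -/
theorem Phi_imagVec_left_eq (hs : R.map Prod.snd = R.map Prod.fst)
    (hs' : R'.map Prod.snd = R'.map Prod.fst) {ρ ρ' : ℝ}
    (hρ0 : 0 < ρ) (hρ2 : ρ < 2) (hρ : R.map Prod.fst ∈ MClass d ρ)
    (hρ'0 : 0 < ρ') (hρ'2 : ρ' < 2) (hρ' : R'.map Prod.fst ∈ MClass d ρ')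
    (hH : H1 R) (hH' : H1 R')
    (key : ∀ z₁ z₂,
      Phi R' z₁ z₂ * (Phi R z₁ 0 * Phi R z₂ 0) = Phi R z₁ z₂ * (Phi R' z₁ 0 * Phi R' z₂ 0))
    (t : EuclideanSpace ℝ (Fin d)) :
    Phi R' (imagVec d t) 0 = Phi R (imagVec d t) 0
      * Complex.exp (-cdot (imagVec d t) (∫ x, x.1 ∂ R - ∫ x, x.1 ∂ R')) := by
  have hR := HasExpMoments.of_mClass hs hρ
  have hR' := HasExpMoments.of_mClass hs' hρ'
  obtain ⟨φ, hφ, hφ0, hφR⟩ := exists_norm_Phi_left_le_exp hρ0 hρ2 hρ t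
  obtain ⟨φ', hφ', hφ'0, hφR'⟩ := exists_norm_Phi_left_le_exp hρ'0 hρ'2 hρ' t
  have hf0 : Phi R 0 0 ≠ 0 := by simp [Phi_zero_zero]
  have hf'0 : Phi R' 0 0 ≠ 0 := by simp [Phi_zero_zero]
  obtain ⟨c, hc⟩ := eq_mul_exp_of_analyticOrderAt_eq
    (hR.lineEntire_Phi_left.differentiable_smul (realVec t))
    (hR'.lineEntire_Phi_left.differentiable_smul (realVec t)) (by simp [Phi_zero_zero])
    (by simp [Phi_zero_zero])
    (fun s => le_antisymm
      (analyticOrderAt_line_le hR.lineEntire_Phi hR'.lineEntire_Phi hR.lineEntire_Phi_left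
        hR'.lineEntire_Phi_left hf'0 key hH.exists_ne _ s)
      (analyticOrderAt_line_le hR'.lineEntire_Phi hR.lineEntire_Phi hR'.lineEntire_Phi_left
        hR.lineEntire_Phi_left hf0 (fun z₁ z₂ => (key z₁ z₂).symm) hH'.exists_ne _ s))
    (hφ.add hφ') (fun r hr => add_nonneg (hφ0 r hr) (hφ'0 r hr))
    (fun s => (hφR s).trans (Real.exp_le_exp.2 (by linarith [hφ'0 _ (norm_nonneg s)])))
    (fun s => (hφR' s).trans (Real.exp_le_exp.2 (by linarith [hφ0 _ (norm_nonneg s)])))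
  -- Comparing derivatives at `0` gives `c = ⟨t, mean of R' - mean of R⟩`; the conclusion is then
  -- the factorization at `s = I`.
  have hder := (hR.hasDerivAt_Phi_zero t).mul ((hasDerivAt_id (0 : ℂ)).const_mul c).cexp
  have hder' := hR'.hasDerivAt_Phi_zero t
  rw [funext hc] at hder'
  have hcv := hder.unique hder'
  simp only [id, mul_zero, Complex.exp_zero, mul_one, zero_smul, Phi_zero_zero, one_mul] at hcv
  have h1 := hc Complex.I
  rw [I_smul_realVec] at h1
  rw [h1, ← I_smul_realVec, cdot_smul_left, cdot_realVec, inner_sub_right]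
  congr 2
  push_cast
  linear_combination Complex.I * hcv

open Filter Asymptotics in
/-- Signals and noises with the same observed transform agree up to translation. -/
theorem exists_translation_of_Phi_mul_eq (hs : R.map Prod.snd = R.map Prod.fst)
    (hs' : R'.map Prod.snd = R'.map Prod.fst)
    (hρ : ∃ ρ : ℝ, 0 < ρ ∧ ρ < 2 ∧ R.map Prod.fst ∈ MClass d ρ)
    (hρ' : ∃ ρ : ℝ, 0 < ρ ∧ ρ < 2 ∧ R'.map Prod.fst ∈ MClass d ρ)
    (hH : H1 R) (hH' : H1 R') (hp0 : p 0 = 1) (hp'0 : p' 0 = 1)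
    (hp : Continuous p) (hp' : Continuous p')
    (hpp : ∀ t₁ t₂, Phi R (imagVec d t₁) (imagVec d t₂) * (p t₁ * p t₂)
      = Phi R' (imagVec d t₁) (imagVec d t₂) * (p' t₁ * p' t₂)) :
    ∃ m : EuclideanSpace ℝ (Fin d), R.map (fun x => (x.1 - m, x.2 - m)) = R' ∧
      ∀ t, p t * Complex.exp (cdot (imagVec d t) m) = p' t := by
  obtain ⟨ρ, hρ0, hρ2, hρ⟩ := hρ
  obtain ⟨ρ', hρ'0, hρ'2, hρ'⟩ := hρ'
  have hR := HasExpMoments.of_mClass hs hρ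
  have hR' := HasExpMoments.of_mClass hs' hρ'
  have key := Phi_mul_marginals_eq hR hR' hp0 hp'0 hp' hpp
  have hmarg := Phi_imagVec_left_eq hs hs' hρ0 hρ2 hρ hρ'0 hρ'2 hρ' hH hH' key
  set m := ∫ x, x.1 ∂ R - ∫ x, x.1 ∂ R' with hm
  have hf0 : Phi R 0 0 ≠ 0 := by simp [Phi_zero_zero]
  refine ⟨m, ?_, fun t => ?_⟩
  · have : IsProbabilityMeasure (R.map fun x => (x.1 - m, x.2 - m)) :=
      Measure.isProbabilityMeasure_map (by fun_prop)
    refine eq_of_Phi_imagVec_eq fun t₁ t₂ => ?_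
    have hff := hR.lineEntire_Phi_mul
    have hD := (hR.map_sub m).lineEntire_Phi.sub hR'.lineEntire_Phi
    -- The transform of the translated `R` minus that of `R'` vanishes after multiplication by
    -- `f(z₁) f(z₂)`; the domain property removes this factor.
    have hzero := (hD.mul hff).eq_zero_of_imagVec fun a b => Eventually.of_forall fun s => by
      have e := key (imagVec d (s • a)) (imagVec d (s • b))
      rw [hmarg, hmarg] at e
      simp only [Phi_map_sub, neg_add, Complex.exp_add]
      generalize Phi R (imagVec d (s • a)) 0 = x at *
      generalize Phi R (imagVec d (s • b)) 0 = y at *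
      linear_combination -e
    by_contra hne
    obtain ⟨z, h1, h2⟩ := hD.exists_mul_ne_zero hff (a := (imagVec d t₁, imagVec d t₂)) (b := 0)
      (sub_ne_zero.2 hne) (mul_ne_zero hf0 hf0)
    exact mul_ne_zero h1 h2 (hzero z)
  · have hcont : Continuous fun t => Complex.exp (cdot (imagVec d t) m) := by
      simp only [cdot_imagVec]
      fun_prop
    -- Where `f(iu) ≠ 0` it cancels from `f p = f' p'`; elsewhere continuity along the ray decides.
    refine congrFun (hR.lineEntire_Phi_left.eq_of_forall_ne_zero hf0 (imagVec d)
      (p := fun t => p t * Complex.exp (cdot (imagVec d t) m)) (q := p') (hp.mul hcont) hp'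
      fun u hu => ?_) t
    have e := hpp u 0
    simp only [hp0, hp'0, map_zero, mul_one, hmarg u] at e
    refine mul_left_cancel₀ hu ?_
    calc Phi R (imagVec d u) 0 * (p u * Complex.exp (cdot (imagVec d u) m))
        = (Phi R (imagVec d u) 0 * p u) * Complex.exp (cdot (imagVec d u) m) := by ring
      _ = _ := by
        rw [e, mul_right_comm, mul_assoc (Phi R _ 0), ← Complex.exp_add, neg_add_cancel,
          Complex.exp_zero, mul_one]

end Identification

/-! ### Transforms of the observations, and the corollary. -/

section Model

variable {Ω E : Type*} [MeasurableSpace Ω] [MeasurableSpace E] {μ : Measure Ω}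
  {Z : ℕ → Ω → E} {g : E → EuclideanSpace ℝ (Fin d)} {ε Y : ℕ → Ω → EuclideanSpace ℝ (Fin d)}

theorem IsHiddenRegression.measurable_signal (h : IsHiddenRegression μ Z g ε Y) (i : ℕ) :
    Measurable fun ω => g (Z i ω) :=
  h.measurable_g.comp (h.measurable_Z i)

theorem IsHiddenRegression.measurable_observation (h : IsHiddenRegression μ Z g ε Y) (i : ℕ) :
    Measurable (Y i) := by
  have : Y i = fun ω => g (Z i ω) + ε i ω := funext (h.observation i)
  rw [this]
  exact (h.measurable_signal i).add (h.measurable_noise i)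

theorem map_fst_pairLaw {F : Type*} [MeasurableSpace F] {X : ℕ → Ω → F}
    (hX : ∀ i, Measurable (X i)) : (pairLaw μ X).map Prod.fst = μ.map (X 0) := by
  rw [pairLaw, Measure.map_map measurable_fst ((hX 0).prodMk (hX 1))]
  rfl

theorem map_snd_pairLaw {F : Type*} [MeasurableSpace F] {X : ℕ → Ω → F}
    (hX : ∀ i, Measurable (X i)) : (pairLaw μ X).map Prod.snd = μ.map (X 1) := by
  rw [pairLaw, Measure.map_map measurable_snd ((hX 0).prodMk (hX 1))]
  rfl

theorem isProbabilityMeasure_pairLaw [IsProbabilityMeasure μ] {F : Type*} [MeasurableSpace F]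
    {X : ℕ → Ω → F} (hX : ∀ i, Measurable (X i)) : IsProbabilityMeasure (pairLaw μ X) :=
  Measure.isProbabilityMeasure_map ((hX 0).prodMk (hX 1)).aemeasurable

theorem IsHiddenRegression.map_snd_eq_map_fst (h : IsHiddenRegression μ Z g ε Y) :
    (pairLaw μ fun i ω => g (Z i ω)).map Prod.snd
      = (pairLaw μ fun i ω => g (Z i ω)).map Prod.fst := by
  rw [map_snd_pairLaw h.measurable_signal, map_fst_pairLaw h.measurable_signal]
  exact ((h.stationary 1).comp (h.measurable_g.comp (measurable_pi_apply 0))).map_eq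

theorem Phi_pairLaw {X : ℕ → Ω → EuclideanSpace ℝ (Fin d)} (hX : ∀ i, Measurable (X i))
    (z₁ z₂ : Fin d → ℂ) :
    Phi (pairLaw μ X) z₁ z₂ = ∫ ω, Complex.exp (cdot z₁ (X 0 ω) + cdot z₂ (X 1 ω)) ∂μ := by
  rw [Phi, pairLaw, integral_map ((hX 0).prodMk (hX 1)).aemeasurable
    (Continuous.aestronglyMeasurable (by fun_prop))]

/-- The transform of the law of two consecutive observations. -/
theorem IsHiddenRegression.Phi_observation (h : IsHiddenRegression μ Z g ε Y)
    (t₁ t₂ : EuclideanSpace ℝ (Fin d)) :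
    Phi (pairLaw μ Y) (imagVec d t₁) (imagVec d t₂)
      = Phi (pairLaw μ fun i ω => g (Z i ω)) (imagVec d t₁) (imagVec d t₂)
        * (charFun (μ.map (ε 0)) t₁ * charFun (μ.map (ε 0)) t₂) := by
  have hexp : ∀ z : Fin d → ℂ, Measurable fun x => Complex.exp (cdot z x) := fun z =>
    Complex.measurable_exp.comp (measurable_cdot z)
  have hexp₂ : Measurable fun x : EuclideanSpace ℝ (Fin d) × EuclideanSpace ℝ (Fin d) =>
      Complex.exp (cdot (imagVec d t₁) x.1) * Complex.exp (cdot (imagVec d t₂) x.2) :=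
    Continuous.measurable (by fun_prop)
  have hnoise : ∀ i t, ∫ ω, Complex.exp (cdot (imagVec d t) (ε i ω)) ∂μ
      = charFun (μ.map (ε 0)) t := fun i t => by
    rw [← (h.identDistrib_noise i).map_eq, charFun_eq_integral_cdot,
      integral_map (h.measurable_noise i).aemeasurable (hexp _).aestronglyMeasurable]
  have hpair : Measurable fun x : ℕ → EuclideanSpace ℝ (Fin d) => (x 0, x 1) := by fun_prop
  -- Independence is used twice: signal pair against noise pair, then one noise against the other.
  have hind := (h.indep_signal_noise.comp hpair hpair).comp hexp₂ hexp₂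
  have hind' := (h.iIndep_noise.indepFun zero_ne_one).comp (hexp (imagVec d t₁))
    (hexp (imagVec d t₂))
  have hX := hexp₂.comp ((h.measurable_signal 0).prodMk (h.measurable_signal 1))
  have hN := hexp₂.comp ((h.measurable_noise 0).prodMk (h.measurable_noise 1))
  have hm0 := (hexp (imagVec d t₁)).comp (h.measurable_noise 0)
  have hm1 := (hexp (imagVec d t₂)).comp (h.measurable_noise 1)
  have e1 := hind.integral_fun_mul_eq_mul_integral hX.aestronglyMeasurable hN.aestronglyMeasurable
  have e2 := hind'.integral_fun_mul_eq_mul_integral hm0.aestronglyMeasurable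
    hm1.aestronglyMeasurable
  simp only [Function.comp_apply, hnoise] at e1 e2
  rw [e2] at e1
  rw [Phi_pairLaw h.measurable_observation, Phi_pairLaw h.measurable_signal]
  simp only [h.observation, cdot_add_right, Complex.exp_add]
  rw [← e1]
  refine integral_congr_ae (Filter.Eventually.of_forall fun ω => ?_)
  ring

theorem charFun_map_add_eq (P : Measure (EuclideanSpace ℝ (Fin d)))
    (m t : EuclideanSpace ℝ (Fin d)) :
    charFun (P.map fun e => e + m) t = charFun P t * Complex.exp (cdot (imagVec d t) m) := by
  rw [charFun_map_add_const, cdot_imagVec]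

end Model

end HiddenRegression

theorem mainTheorem5 {d : ℕ} {Ω Ω' E E' : Type*}
    [MeasurableSpace Ω] [MeasurableSpace Ω'] [MeasurableSpace E] [MeasurableSpace E']
    (μ : Measure Ω) [IsProbabilityMeasure μ] (μ' : Measure Ω') [IsProbabilityMeasure μ']
    (Z : ℕ → Ω → E) (g : E → EuclideanSpace ℝ (Fin d))
    (ε Y : ℕ → Ω → EuclideanSpace ℝ (Fin d))
    (Z' : ℕ → Ω' → E') (g' : E' → EuclideanSpace ℝ (Fin d))
    (ε' Y' : ℕ → Ω' → EuclideanSpace ℝ (Fin d))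
    (hmodel : HiddenRegression.IsHiddenRegression μ Z g ε Y)
    (hmodel' : HiddenRegression.IsHiddenRegression μ' Z' g' ε' Y')
    (htail : ∃ ρ : ℝ, 0 < ρ ∧ ρ < 2 ∧
      μ.map (fun ω => g (Z 0 ω)) ∈ HiddenRegression.MClass d ρ)
    (htail' : ∃ ρ : ℝ, 0 < ρ ∧ ρ < 2 ∧
      μ'.map (fun ω => g' (Z' 0 ω)) ∈ HiddenRegression.MClass d ρ)
    (hH1 : HiddenRegression.H1 (HiddenRegression.pairLaw μ (fun i ω => g (Z i ω))))
    (hH1' : HiddenRegression.H1 (HiddenRegression.pairLaw μ' (fun i ω => g' (Z' i ω)))) :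
    HiddenRegression.pairLaw μ Y = HiddenRegression.pairLaw μ' Y' ↔
      HiddenRegression.EqUpToTranslation
        (HiddenRegression.pairLaw μ (fun i ω => g (Z i ω))) (μ.map (ε 0))
        (HiddenRegression.pairLaw μ' (fun i ω => g' (Z' i ω))) (μ'.map (ε' 0)) := by
  have := HiddenRegression.isProbabilityMeasure_pairLaw (μ := μ) hmodel.measurable_signal
  have := HiddenRegression.isProbabilityMeasure_pairLaw (μ := μ') hmodel'.measurable_signal
  have := HiddenRegression.isProbabilityMeasure_pairLaw (μ := μ) hmodel.measurable_observation
  have := HiddenRegression.isProbabilityMeasure_pairLaw (μ := μ') hmodel'.measurable_observation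
  have hP : IsProbabilityMeasure (μ.map (ε 0)) :=
    Measure.isProbabilityMeasure_map (hmodel.measurable_noise 0).aemeasurable
  have hP' : IsProbabilityMeasure (μ'.map (ε' 0)) :=
    Measure.isProbabilityMeasure_map (hmodel'.measurable_noise 0).aemeasurable
  constructor
  · intro hY
    obtain ⟨m, hR, hcf⟩ := HiddenRegression.exists_translation_of_Phi_mul_eq
      (p := charFun (μ.map (ε 0))) (p' := charFun (μ'.map (ε' 0)))
      hmodel.map_snd_eq_map_fst hmodel'.map_snd_eq_map_fst
      (by rwa [HiddenRegression.map_fst_pairLaw hmodel.measurable_signal])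
      (by rwa [HiddenRegression.map_fst_pairLaw hmodel'.measurable_signal])
      hH1 hH1' (by simp) (by simp) continuous_charFun continuous_charFun
      (fun t₁ t₂ => by rw [← hmodel.Phi_observation, ← hmodel'.Phi_observation, hY])
    refine ⟨m, hR, ?_⟩
    have : IsProbabilityMeasure ((μ.map (ε 0)).map fun e => e + m) :=
      Measure.isProbabilityMeasure_map (by fun_prop)
    refine Measure.ext_of_charFun (funext fun t => ?_)
    rw [HiddenRegression.charFun_map_add_eq, hcf]
  · rintro ⟨m, hR, hP⟩
    refine HiddenRegression.eq_of_Phi_imagVec_eq fun t₁ t₂ => ?_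
    rw [hmodel.Phi_observation, hmodel'.Phi_observation, ← hR, ← hP,
      HiddenRegression.Phi_map_sub, HiddenRegression.charFun_map_add_eq,
      HiddenRegression.charFun_map_add_eq]
    -- The translation of the signal by `-m` and that of the noise by `m` contribute inverse
    -- factors.
    have hexp : Complex.exp (-(HiddenRegression.cdot (HiddenRegression.imagVec d t₁) m
        + HiddenRegression.cdot (HiddenRegression.imagVec d t₂) m))
        * (Complex.exp (HiddenRegression.cdot (HiddenRegression.imagVec d t₁) m)
        * Complex.exp (HiddenRegression.cdot (HiddenRegression.imagVec d t₂) m)) = 1 := by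
      rw [← Complex.exp_add, ← Complex.exp_add, neg_add_cancel, Complex.exp_zero]
    linear_combination (-HiddenRegression.Phi (HiddenRegression.pairLaw μ fun i ω => g (Z i ω))
      (HiddenRegression.imagVec d t₁) (HiddenRegression.imagVec d t₂)
      * charFun (μ.map (ε 0)) t₁ * charFun (μ.map (ε 0)) t₂) * hexp
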